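/- Let $n\ge 2$, let $S^{n-1}\subset\mathbb R^n$ be the unit sphere with its surface measure $\sigma$, and let $\mu\in S^{n-1}$. For $\theta\in[0,\pi]$ let $$\Theta(\theta)=\frac{\sigma\{x\in S^{n-1}:\ \langle x,\mu\rangle\ge\cos\theta\}}{\sigma(S^{n-1})}$$ be the fraction of the surface of the sphere lying within planar angle $\theta$ of the axis $\mu$. Let $B(\alpha,\beta)=\Gamma(\alpha)\Gamma(\beta)/\Gamma(\alpha+\beta)$ be the beta function and let $$I_x(\alpha,\beta)=\frac1{B(\alpha,\beta)}\int_0^x t^{\alpha-1}(1-t)^{\beta-1}\,dt\qquad(0\le x\le 1)$$ be the regularized incomplete beta function. Then for all $\theta\in[0,\pi]$ $$\Theta(\theta)=\frac{1}{B\left(\frac{n-1}2,\frac12\right)}\int_0^\theta\sin^{n-2}x\,dx,$$ and $$\Theta(\theta)=\begin{cases}\frac12\,I_{\sin^2\theta}\left(\frac{n-1}2,\frac12\right), & \theta\in[0,\frac\pi2],\\[2pt] 1-\frac12\,I_{\sin^2\theta}\left(\frac{n-1}2,\frac12\right), & \theta\in[\frac\pi2,\pi].\end{cases}$$ Moreover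 $x\mapsto I_x\left(\frac{n-1}2,\frac12\right)$ is a bijection of $[0,1]$ onto $[0,1]$; write $I^{-1}_y\left(\frac{n-1}2,\frac12\right)$ for the $x\in[0,1]$ with $I_x\left(\frac{n-1}2,\frac12\right)=y$. Also $\Theta$ is a bijection of $[0,\pi]$ onto $[0,1]$, and its inverse is $$\Theta^{-1}(\Omega)=\begin{cases}\arcsin\sqrt{I^{-1}_{2\Omega}\left(\frac{n-1}2,\frac12\right)}, & \Omega\in[0,\frac12],\\[2pt] \pi-\arcsin\sqrt{I^{-1}_{2(1-\Omega)}\left(\frac{n-1}2,\frac12\right)}, & \Omega\in[\frac12,1].\end{cases}$$ -/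

import Mathlib

noncomputable section

/-- The unit sphere `S^{n-1}` in `n`-dimensional Euclidean space. -/
abbrev unitSphere (n : ℕ) : Type := Metric.sphere (0 : EuclideanSpace ℝ (Fin n)) 1

/-- The spherical cap of all unit vectors within planar angle `θ` of the axis `μ`. -/
def sphericalCap {n : ℕ} (μ : unitSphere n) (θ : ℝ) : Set (unitSphere n) :=
  {x | Real.cos θ ≤ inner ℝ (x : EuclideanSpace ℝ (Fin n)) (μ : EuclideanSpace ℝ (Fin n))}

/-- The surface measure on the unit sphere `S^{n-1}`. -/
def surfaceMeasure (n : ℕ) : MeasureTheory.Measure (unitSphere n) :=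
  (MeasureTheory.volume : MeasureTheory.Measure (EuclideanSpace ℝ (Fin n))).toSphere

/-- `Θ(θ)`: the fraction of the surface area of `S^{n-1}` that lies within planar angle `θ`
of the axis `μ`. -/
def solidAngleFraction {n : ℕ} (μ : unitSphere n) (θ : ℝ) : ℝ :=
  (surfaceMeasure n).real (sphericalCap μ θ) / (surfaceMeasure n).real Set.univ

/-- `Θ⁻¹(Ω)`: the angle in `[0, π]` whose solid angle fraction is `Ω`. -/
def invSolidAngleFraction {n : ℕ} (μ : unitSphere n) (Ω : ℝ) : ℝ :=
  Function.invFunOn (solidAngleFraction μ) (Set.Icc 0 Real.pi) Ω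

/-- The regularized incomplete beta function `I_x(α, β)`. -/
def regIncBeta (α β x : ℝ) : ℝ :=
  1 / ProbabilityTheory.beta α β * ∫ t in (0 : ℝ)..x, t ^ (α - 1) * (1 - t) ^ (β - 1)

/-- The inverse `I⁻¹_y(α, β)`: the `x` in `[0, 1]` with `I_x(α, β) = y`. -/
def invRegIncBeta (α β y : ℝ) : ℝ :=
  Function.invFunOn (regIncBeta α β) (Set.Icc 0 1) y

end

/-! Write `n = m + 2`. The surface measure of a cap is `n` times the volume of the solid cone over
it in the unit ball. Split the space as the axis plus its orthogonal complement, of dimension `m +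
1`. The cone is rotationally symmetric, so radial integration in the complement makes its volume a
constant times the integral of `y ^ m` over a sector of the upper half disc
(`exists_volume_cone_eq`). Planar polar coordinates factor that integral into a radial constant and
`∫ sin ^ m` over `[0, θ]` (`exists_lintegral_planar_cone`). The constants do not depend on `θ`, so
they cancel against the full sphere, `θ = π`.

The substitution `t = sin² x` (`integral_incBeta_sin_sq`) identifies the normalisation with the beta
function and gives the formula on `[0, π/2]`; the reflection `θ ↦ π - θ` gives the other half. The
inverse formulas then follow from injectivity. -/

open MeasureTheory Set
open scoped ENNReal NNReal

/-! ### Radial integration, orthogonal splitting and the planar sector -/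

section
variable {F : Type*} [NormedAddCommGroup F] [NormedSpace ℝ F] [MeasurableSpace F]
  [BorelSpace F] [FiniteDimensional ℝ F] [Nontrivial F]

/-- Integration of a radial function in polar coordinates. -/
lemma lintegral_fun_norm_addHaar (μ : Measure F) [μ.IsAddHaarMeasure] {f : ℝ → ℝ≥0∞}
    (hf : Measurable f) :
    ∫⁻ x, f ‖x‖ ∂μ = μ.toSphere univ *
      ∫⁻ r in Ioi (0 : ℝ), ENNReal.ofReal (r ^ (Module.finrank ℝ F - 1)) * f r := by
  calc
    ∫⁻ x, f ‖x‖ ∂μ = ∫⁻ x : ({(0)}ᶜ : Set F), f ‖x.1‖ ∂(μ.comap (↑)) := by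
      rw [lintegral_subtype_comap (measurableSet_singleton _).compl fun x ↦ f ‖x‖,
        restrict_compl_singleton]
    _ = ∫⁻ x, f x.2 ∂μ.toSphere.prod (.volumeIoiPow (Module.finrank ℝ F - 1)) := by
      simpa using μ.measurePreserving_homeomorphUnitSphereProd.lintegral_comp_emb
        (Homeomorph.measurableEmbedding _) (f ∘ Subtype.val ∘ Prod.snd)
    _ = μ.toSphere univ * ∫⁻ x : Ioi (0 : ℝ), f x ∂.volumeIoiPow (Module.finrank ℝ F - 1) := by
      rw [lintegral_prod _ (by fun_prop)]
      simp [mul_comm]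
    _ = _ := by
      rw [Measure.volumeIoiPow, lintegral_withDensity_eq_lintegral_mul _ (by fun_prop) (by fun_prop)]
      congr 1
      exact lintegral_subtype_comap measurableSet_Ioi
        fun r : ℝ ↦ ENNReal.ofReal (r ^ (Module.finrank ℝ F - 1)) * f r
end

section
variable {E : Type*} [NormedAddCommGroup E] [InnerProductSpace ℝ E] [FiniteDimensional ℝ E]

/-- The splitting of a Euclidean space into the line through a unit vector and its orthogonal
complement. -/
lemma exists_continuousLinearEquiv_prod_orthogonal {v : E} (hv : ‖v‖ = 1) :
    ∃ ψ : E ≃L[ℝ] ℝ × (Submodule.span ℝ {v})ᗮ,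
      ∀ x, inner ℝ x v = (ψ x).1 ∧ ‖x‖ ^ 2 = (ψ x).1 ^ 2 + ‖(ψ x).2‖ ^ 2 := by
  have hvv : inner ℝ v v = 1 := by simp [hv]
  have horth : ∀ y : (Submodule.span ℝ {v})ᗮ, inner ℝ v (y : E) = 0 := fun y ↦
    Submodule.mem_orthogonal_singleton_iff_inner_right.1 y.2
  let φ : ℝ × (Submodule.span ℝ {v})ᗮ →ₗ[ℝ] E :=
    (LinearMap.toSpanSingleton ℝ E v).coprod (Submodule.subtype _)
  have hφ : ∀ p, φ p = p.1 • v + (p.2 : E) := fun p ↦ by simp [φ]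
  have hinner : ∀ p, inner ℝ (φ p) v = p.1 := fun p ↦ by
    rw [hφ, inner_add_left, inner_smul_left, hvv, real_inner_comm, horth]; simp
  have hnorm : ∀ p, ‖φ p‖ ^ 2 = p.1 ^ 2 + ‖p.2‖ ^ 2 := fun p ↦ by
    rw [hφ, norm_add_sq_real, inner_smul_left, horth, norm_smul, hv]; simp
  have hbij : Function.Bijective φ := by
    refine ⟨(injective_iff_map_eq_zero φ).2 fun p hp ↦ ?_, fun x ↦ ?_⟩
    · have h := hnorm p
      rw [hp, norm_zero] at h
      have h1 : p.1 = 0 := by nlinarith [sq_nonneg p.1, sq_nonneg ‖p.2‖]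
      have h2 : ‖p.2‖ = 0 := by nlinarith [sq_nonneg p.1, sq_nonneg ‖p.2‖]
      exact Prod.ext h1 (norm_eq_zero.1 h2)
    · refine ⟨(inner ℝ v x, ⟨x - inner ℝ v x • v, ?_⟩), by simp [hφ]⟩
      rw [Submodule.mem_orthogonal_singleton_iff_inner_right, inner_sub_right, inner_smul_right,
        hvv]
      simp
  refine ⟨(LinearEquiv.ofBijective φ hbij).symm.toContinuousLinearEquiv, fun x ↦ ?_⟩
  obtain ⟨p, rfl⟩ := hbij.2 x
  have : (LinearEquiv.ofBijective φ hbij).symm.toContinuousLinearEquiv (φ p) = p :=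
    (LinearEquiv.ofBijective φ hbij).symm_apply_apply p
  rw [this]
  exact ⟨hinner p, hnorm p⟩
end

/-- A planar cone integral in polar coordinates. -/
lemma exists_lintegral_planar_cone (m : ℕ) : ∃ D : ℝ≥0∞, ∀ θ ∈ Icc 0 Real.pi,
    ∫⁻ p : ℝ × ℝ, ({p : ℝ × ℝ | 0 < p.2 ∧ p.1 ^ 2 + p.2 ^ 2 < 1 ∧
      Real.cos θ * √(p.1 ^ 2 + p.2 ^ 2) ≤ p.1}.indicator
        (fun p ↦ ENNReal.ofReal (p.2 ^ m)) p) =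
    D * ENNReal.ofReal (∫ x in (0 : ℝ)..θ, Real.sin x ^ m) := by
  -- In `r ^ (m + 1)`, `r ^ m` comes from `(r sin φ) ^ m` and one more `r` from the Jacobian.
  refine ⟨∫⁻ r : ℝ, (Ioo 0 1).indicator (fun r ↦ ENNReal.ofReal (r ^ (m + 1))) r, fun θ hθ ↦ ?_⟩
  have hsin : ENNReal.ofReal (∫ x in (0 : ℝ)..θ, Real.sin x ^ m) =
      ∫⁻ x, (Ioc 0 θ).indicator (fun x ↦ ENNReal.ofReal (Real.sin x ^ m)) x := by
    rw [lintegral_indicator measurableSet_Ioc, intervalIntegral.integral_of_le hθ.1,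
      ofReal_integral_eq_lintegral_ofReal]
    · exact (Continuous.integrableOn_Ioc (by fun_prop))
    · filter_upwards [ae_restrict_mem measurableSet_Ioc] with x hx
      exact pow_nonneg (Real.sin_nonneg_of_nonneg_of_le_pi hx.1.le (hx.2.trans hθ.2)) _
  -- The polar chart has angles in the open interval `(-π, π)`, so the null point `π` is dropped.
  have hsin' : ∫⁻ x, (Ioc 0 θ).indicator (fun x ↦ ENNReal.ofReal (Real.sin x ^ m)) x =
      ∫⁻ x, (Ioc 0 θ \ {Real.pi}).indicator (fun x ↦ ENNReal.ofReal (Real.sin x ^ m)) x := by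
    rw [lintegral_indicator measurableSet_Ioc,
      lintegral_indicator (measurableSet_Ioc.diff (measurableSet_singleton _))]
    exact (setLIntegral_congr (sdiff_null_ae_eq_self (by simp))).symm
  rw [hsin, hsin', ← lintegral_prod_mul
    ((Measurable.indicator (by fun_prop) measurableSet_Ioo).aemeasurable)
    ((Measurable.indicator (by fun_prop)
      (measurableSet_Ioc.diff (measurableSet_singleton _))).aemeasurable),
    ← lintegral_comp_polarCoord_symm, ← lintegral_indicator polarCoord.open_target.measurableSet,
    ← Measure.volume_eq_prod]
  congr 1 with ⟨r, φ⟩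
  by_cases hr : 0 < r
  swap
  · rw [indicator_of_notMem (by simp [polarCoord_target, hr])]
    simp [hr]
  have hsq : (r * Real.cos φ) ^ 2 + (r * Real.sin φ) ^ 2 = r ^ 2 := by
    rw [mul_pow, mul_pow, ← mul_add, Real.cos_sq_add_sin_sq, mul_one]
  have hcond : (φ ∈ Ioo (-Real.pi) Real.pi ∧ 0 < r * Real.sin φ ∧ r ^ 2 < 1 ∧
      Real.cos θ * √(r ^ 2) ≤ r * Real.cos φ) ↔ r < 1 ∧ φ ∈ Ioc 0 θ \ {Real.pi} := by
    rw [Real.sqrt_sq hr.le, mul_comm (Real.cos θ), mul_le_mul_iff_right₀ hr,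
      mul_pos_iff_of_pos_left hr, sq_lt_one_iff₀ hr.le]
    simp only [mem_sdiff, mem_Ioc, mem_Ioo, mem_singleton_iff]
    constructor
    · rintro ⟨⟨h1, h2⟩, h3, h4, h5⟩
      have h0 : 0 < φ := by
        by_contra! h
        exact h3.not_ge (Real.sin_nonpos_of_nonpos_of_neg_pi_le h h1.le)
      refine ⟨h4, ⟨h0, ?_⟩, h2.ne⟩
      exact (Real.strictAntiOn_cos.le_iff_ge hθ ⟨h0.le, h2.le⟩).1 h5
    · rintro ⟨h4, ⟨h0, h5⟩, h2⟩
      have h2' : φ < Real.pi := lt_of_le_of_ne (h5.trans hθ.2) h2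
      exact ⟨⟨by linarith, h2'⟩, Real.sin_pos_of_pos_of_lt_pi h0 h2', h4,
        (Real.strictAntiOn_cos.le_iff_ge hθ ⟨h0.le, h2'.le⟩).2 h5⟩
  simp only [indicator_apply, polarCoord_target, polarCoord_symm_apply, mem_prod, mem_Ioi,
    smul_eq_mul, mem_ofPred_eq, hsq, hr, true_and]
  by_cases h : r < 1 ∧ φ ∈ Ioc 0 θ \ {Real.pi}
  · obtain ⟨h1, h2⟩ := hcond.2 h
    rw [if_pos h1, if_pos h2, if_pos ⟨hr, h.1⟩, if_pos h.2, ← ENNReal.ofReal_mul hr.le,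
      ← ENNReal.ofReal_mul (by positivity)]
    congr 1
    ring
  · have h' := mt hcond.1 h
    trans 0
    · split_ifs with h1 h2
      · exact absurd ⟨h1, h2⟩ h'
      · simp
      · rfl
    · symm
      split_ifs with h1 h2
      · exact absurd ⟨h1.2, h2⟩ h
      all_goals simp

/-! ### Sine integrals and the incomplete beta function -/

/-- The substitution `t = sin² x` in the incomplete beta integral. -/
lemma integral_incBeta_sin_sq (m : ℕ) {θ : ℝ} (hθ : θ ∈ Icc 0 (Real.pi / 2)) :
    ∫ t in (0 : ℝ)..Real.sin θ ^ 2, t ^ (((m : ℝ) + 1) / 2 - 1) * (1 - t) ^ ((1 : ℝ) / 2 - 1) =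
      2 * ∫ x in (0 : ℝ)..θ, Real.sin x ^ m := by
  have hpi := Real.pi_pos
  have hmono : StrictMonoOn (fun x ↦ Real.sin x ^ 2) (Icc 0 (Real.pi / 2)) := by
    intro x hx y hy hxy
    have h0 : 0 ≤ Real.sin x := Real.sin_nonneg_of_nonneg_of_le_pi hx.1 (by linarith [hx.2])
    exact pow_lt_pow_left₀
      (Real.strictMonoOn_sin ⟨by linarith [hx.1], hx.2⟩ ⟨by linarith [hy.1], hy.2⟩ hxy) h0 two_ne_zero
  -- Open intervals avoid the endpoints, where the sine or cosine may vanish and the real powers no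
  -- longer combine.
  have himage : (fun x ↦ Real.sin x ^ 2) '' Ioo 0 θ = Ioo 0 (Real.sin θ ^ 2) := by
    apply Subset.antisymm
    · rintro _ ⟨x, hx, rfl⟩
      have hx' : x ∈ Icc 0 (Real.pi / 2) := ⟨hx.1.le, hx.2.le.trans hθ.2⟩
      exact ⟨by simpa using hmono ⟨le_rfl, by linarith⟩ hx' hx.1, hmono hx' hθ hx.2⟩
    · have h : Ioo (Real.sin 0 ^ 2) (Real.sin θ ^ 2) ⊆ (fun x ↦ Real.sin x ^ 2) '' Ioo 0 θ :=
        intermediate_value_Ioo (f := fun x ↦ Real.sin x ^ 2) hθ.1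
          (Continuous.continuousOn (by fun_prop))
      rwa [Real.sin_zero, zero_pow two_ne_zero] at h
  rw [intervalIntegral.integral_of_le (by positivity), intervalIntegral.integral_of_le hθ.1,
    integral_Ioc_eq_integral_Ioo, integral_Ioc_eq_integral_Ioo, ← himage,
    integral_image_eq_integral_abs_deriv_smul (f' := fun x ↦ 2 * Real.sin x * Real.cos x)
      measurableSet_Ioo (fun x _ ↦ ?_)
      (hmono.injOn.mono (Ioo_subset_Icc_self.trans (Icc_subset_Icc_right hθ.2))),
    ← integral_const_mul]
  · refine setIntegral_congr_fun measurableSet_Ioo fun x hx ↦ ?_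
    have hs : 0 < Real.sin x :=
      Real.sin_pos_of_pos_of_lt_pi hx.1 (by linarith [hx.2, hθ.2])
    have hc : 0 < Real.cos x :=
      Real.cos_pos_of_mem_Ioo ⟨by linarith [hx.1], by linarith [hx.2, hθ.2]⟩
    have h1 : (Real.sin x ^ 2) ^ (((m : ℝ) + 1) / 2 - 1) * Real.sin x = Real.sin x ^ m := by
      rw [← Real.rpow_natCast (Real.sin x) 2, ← Real.rpow_mul hs.le, ← Real.rpow_add_one hs.ne',
        ← Real.rpow_natCast]
      congr 1
      push_cast
      ring
    have h2 : (1 - Real.sin x ^ 2) ^ ((1 : ℝ) / 2 - 1) * Real.cos x = 1 := by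
      rw [← Real.cos_sq', ← Real.rpow_natCast (Real.cos x) 2, ← Real.rpow_mul hc.le,
        ← Real.rpow_add_one hc.ne']
      norm_num
    simp only [smul_eq_mul]
    rw [abs_of_pos (by positivity), ← h1]
    linear_combination
      2 * (Real.sin x ^ 2) ^ (((m : ℝ) + 1) / 2 - 1) * Real.sin x * h2
  · simpa using ((Real.hasDerivAt_sin x).fun_pow 2).hasDerivWithinAt

lemma ProbabilityTheory.beta_eq_integral {α β : ℝ} (hα : 0 < α) (hβ : 0 < β) :
    ProbabilityTheory.beta α β = ∫ t in (0 : ℝ)..1, t ^ (α - 1) * (1 - t) ^ (β - 1) := by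
  rw [beta_eq_betaIntegralReal α β hα hβ, Complex.betaIntegral,
    intervalIntegral.integral_of_le zero_le_one, intervalIntegral.integral_of_le zero_le_one,
    ← RCLike.re_to_complex, ← integral_re]
  · refine setIntegral_congr_fun measurableSet_Ioc fun x ⟨hx1, hx₂⟩ ↦ ?_
    norm_cast
    rw [← Complex.ofReal_cpow, ← Complex.ofReal_cpow, RCLike.re_to_complex,
      Complex.re_mul_ofReal, Complex.ofReal_re]
    all_goals linarith
  · convert! Complex.betaIntegral_convergent (u := α) (v := β) (by simpa) (by simpa)
    rw [intervalIntegrable_iff_integrableOn_Ioc_of_le (by simp), IntegrableOn]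

lemma integral_sin_pow_pi_sub (m : ℕ) (θ : ℝ) :
    ∫ x in (0 : ℝ)..(Real.pi - θ), Real.sin x ^ m =
      (∫ x in (0 : ℝ)..Real.pi, Real.sin x ^ m) - ∫ x in (0 : ℝ)..θ, Real.sin x ^ m := by
  have hint (a b : ℝ) : IntervalIntegrable (fun x ↦ Real.sin x ^ m) volume a b :=
    Continuous.intervalIntegrable (by fun_prop) a b
  have h := intervalIntegral.integral_comp_sub_left (a := θ) (b := Real.pi)
    (fun x ↦ Real.sin x ^ m) Real.pi
  simp only [Real.sin_pi_sub, sub_self] at h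
  rw [← h, ← intervalIntegral.integral_add_adjacent_intervals (hint 0 θ) (hint θ Real.pi)]
  ring

/-- The substitution covers only `[0, π/2]`; its factor 2 is absorbed by reflecting onto `[π/2, π]`.
-/
lemma beta_eq_integral_sin_pow (m : ℕ) :
    ProbabilityTheory.beta (((m : ℝ) + 1) / 2) (1 / 2) =
      ∫ x in (0 : ℝ)..Real.pi, Real.sin x ^ m := by
  have h := integral_incBeta_sin_sq m (θ := Real.pi / 2) ⟨by positivity, le_rfl⟩
  rw [Real.sin_pi_div_two, one_pow] at h
  rw [ProbabilityTheory.beta_eq_integral (by positivity) (by positivity), h]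
  have h2 := integral_sin_pow_pi_sub m (Real.pi / 2)
  rw [sub_half] at h2
  linarith

lemma strictMonoOn_integral_sin_pow (m : ℕ) :
    StrictMonoOn (fun θ ↦ ∫ x in (0 : ℝ)..θ, Real.sin x ^ m) (Icc 0 Real.pi) := by
  intro a ha b hb hab
  have hint (a b : ℝ) : IntervalIntegrable (fun x ↦ Real.sin x ^ m) volume a b :=
    Continuous.intervalIntegrable (by fun_prop) a b
  dsimp only
  rw [← sub_pos, intervalIntegral.integral_interval_sub_left (hint _ _) (hint _ _)]
  exact intervalIntegral.intervalIntegral_pos_of_pos_on (hint _ _) (fun x hx ↦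
    pow_pos (Real.sin_pos_of_pos_of_lt_pi (ha.1.trans_lt hx.1) (hx.2.trans_le hb.2)) m) hab

lemma strictMonoOn_integral_sin_pow_div_beta (m : ℕ) :
    StrictMonoOn (fun θ ↦ 1 / ProbabilityTheory.beta (((m : ℝ) + 1) / 2) (1 / 2) *
      ∫ x in (0 : ℝ)..θ, Real.sin x ^ m) (Icc 0 Real.pi) := fun _ ha _ hb hab ↦
  mul_lt_mul_of_pos_left (strictMonoOn_integral_sin_pow m ha hb hab)
    (one_div_pos.2 (ProbabilityTheory.beta_pos (by positivity) (by positivity)))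

lemma bijOn_integral_sin_pow_div_beta (m : ℕ) :
    BijOn (fun θ ↦ 1 / ProbabilityTheory.beta (((m : ℝ) + 1) / 2) (1 / 2) *
      ∫ x in (0 : ℝ)..θ, Real.sin x ^ m) (Icc 0 Real.pi) (Icc 0 1) := by
  have hB : 0 < ProbabilityTheory.beta (((m : ℝ) + 1) / 2) (1 / 2) :=
    ProbabilityTheory.beta_pos (by positivity) (by positivity)
  have hmono := strictMonoOn_integral_sin_pow_div_beta m
  have hcont : Continuous fun θ ↦ 1 / ProbabilityTheory.beta (((m : ℝ) + 1) / 2) (1 / 2) *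
      ∫ x in (0 : ℝ)..θ, Real.sin x ^ m :=
    continuous_const.mul (intervalIntegral.continuous_primitive
      (fun a b ↦ Continuous.intervalIntegrable (by fun_prop) a b) 0)
  have h := hcont.continuousOn.image_Icc_of_monotoneOn Real.pi_pos.le hmono.monotoneOn
  simp only [← beta_eq_integral_sin_pow, intervalIntegral.integral_same, mul_zero,
    one_div_mul_cancel hB.ne'] at h
  exact h ▸ hmono.injOn.bijOn_image

lemma regIncBeta_sin_sq (m : ℕ) {θ : ℝ} (hθ : θ ∈ Icc 0 (Real.pi / 2)) :
    regIncBeta (((m : ℝ) + 1) / 2) (1 / 2) (Real.sin θ ^ 2) =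
      2 * (1 / ProbabilityTheory.beta (((m : ℝ) + 1) / 2) (1 / 2) *
        ∫ x in (0 : ℝ)..θ, Real.sin x ^ m) := by
  rw [regIncBeta, integral_incBeta_sin_sq m hθ]
  ring

lemma arcsin_sqrt_mem_Icc (x : ℝ) : Real.arcsin √x ∈ Icc 0 (Real.pi / 2) :=
  ⟨Real.arcsin_nonneg.2 (Real.sqrt_nonneg x), Real.arcsin_le_pi_div_two _⟩

lemma sin_arcsin_sqrt_sq {x : ℝ} (hx : x ∈ Icc 0 1) : Real.sin (Real.arcsin √x) ^ 2 = x := by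
  rw [Real.sin_arcsin (by linarith [Real.sqrt_nonneg x]) (Real.sqrt_le_one.2 hx.2),
    Real.sq_sqrt hx.1]

lemma arcsin_sqrt_sin_sq {θ : ℝ} (hθ : θ ∈ Icc 0 (Real.pi / 2)) :
    Real.arcsin √(Real.sin θ ^ 2) = θ := by
  have := Real.pi_pos
  rw [Real.sqrt_sq (Real.sin_nonneg_of_nonneg_of_le_pi hθ.1 (by linarith [hθ.2])),
    Real.arcsin_sin (by linarith [hθ.1]) hθ.2]

/-- Under `x = sin² θ` the function becomes `2 * G θ` on `[0, π/2]`, and `G (π / 2) = 1 / 2`, so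
bijectivity is inherited from `G`. -/
lemma bijOn_regIncBeta (m : ℕ) :
    BijOn (regIncBeta (((m : ℝ) + 1) / 2) (1 / 2)) (Icc 0 1) (Icc 0 1) := by
  have hB : 0 < ProbabilityTheory.beta (((m : ℝ) + 1) / 2) (1 / 2) :=
    ProbabilityTheory.beta_pos (by positivity) (by positivity)
  have hpi := Real.pi_pos
  have hG := bijOn_integral_sin_pow_div_beta m
  have hmono := strictMonoOn_integral_sin_pow_div_beta m
  set G : ℝ → ℝ := fun θ ↦ 1 / ProbabilityTheory.beta (((m : ℝ) + 1) / 2) (1 / 2) *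
      ∫ x in (0 : ℝ)..θ, Real.sin x ^ m
  have hhalf : G (Real.pi / 2) = 1 / 2 := by
    have h2 := integral_sin_pow_pi_sub m (Real.pi / 2)
    rw [sub_half, ← beta_eq_integral_sin_pow] at h2
    simp only [G]
    field_simp
    linarith
  have hsub : Icc 0 (Real.pi / 2) ⊆ Icc 0 Real.pi := Icc_subset_Icc_right (by linarith)
  have key : ∀ x ∈ Icc (0 : ℝ) 1,
      regIncBeta (((m : ℝ) + 1) / 2) (1 / 2) x = 2 * G (Real.arcsin √x) := fun x hx ↦ by
    conv_lhs => rw [← sin_arcsin_sqrt_sq hx]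
    exact regIncBeta_sin_sq m (arcsin_sqrt_mem_Icc x)
  refine ⟨fun x hx ↦ ?_, fun x hx y hy hxy ↦ ?_, fun y hy ↦ ?_⟩
  · have hm := arcsin_sqrt_mem_Icc x
    have h1 := hmono.monotoneOn (hsub hm) ⟨by linarith, by linarith⟩ hm.2
    have h0 := (hG.mapsTo (hsub hm)).1
    change G _ ≤ G _ at h1
    rw [key x hx]
    constructor <;> linarith
  · rw [key x hx, key y hy] at hxy
    have h := hG.injOn (hsub (arcsin_sqrt_mem_Icc x)) (hsub (arcsin_sqrt_mem_Icc y)) (by linarith)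
    rw [← sin_arcsin_sqrt_sq hx, ← sin_arcsin_sqrt_sq hy, h]
  · obtain ⟨θ, hθ, hGθ⟩ := hG.surjOn (show y / 2 ∈ Icc (0 : ℝ) 1 from
      ⟨by linarith [hy.1], by linarith [hy.2]⟩)
    have hle : θ ≤ Real.pi / 2 := by
      refine (hmono.le_iff_le hθ ⟨by linarith, by linarith⟩).1 ?_
      change G _ ≤ G _
      rw [hGθ, hhalf]
      linarith [hy.2]
    refine ⟨Real.sin θ ^ 2, ⟨sq_nonneg _, Real.sin_sq_le_one θ⟩, ?_⟩
    rw [key _ ⟨sq_nonneg _, Real.sin_sq_le_one θ⟩, arcsin_sqrt_sin_sq ⟨hθ.1, hle⟩, hGθ]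
    ring

/-! ### Caps, cones and their measure -/

open scoped Pointwise in
lemma Ioo_smul_image_sphericalCap {n : ℕ} (μ : unitSphere n) (θ : ℝ) :
    Ioo (0 : ℝ) 1 • ((↑) '' sphericalCap μ θ : Set (EuclideanSpace ℝ (Fin n))) =
      {x | x ≠ 0 ∧ ‖x‖ < 1 ∧
        Real.cos θ * ‖x‖ ≤ inner ℝ x (μ : EuclideanSpace ℝ (Fin n))} := by
  ext x
  rw [mem_smul]
  constructor
  · rintro ⟨r, hr, _, ⟨u, hu, rfl⟩, rfl⟩
    have hnorm : ‖r • (u : EuclideanSpace ℝ (Fin n))‖ = r := by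
      rw [norm_smul, norm_eq_of_mem_sphere u, mul_one, Real.norm_of_nonneg hr.1.le]
    refine ⟨fun h ↦ hr.1.ne' (by rw [← hnorm, h, norm_zero]), hnorm.trans_lt hr.2, ?_⟩
    rw [hnorm, real_inner_smul_left, mul_comm]
    exact mul_le_mul_of_nonneg_left hu hr.1.le
  · rintro ⟨h0, h1, h2⟩
    have hpos : 0 < ‖x‖ := norm_pos_iff.2 h0
    refine ⟨‖x‖, ⟨hpos, h1⟩, ‖x‖⁻¹ • x, ⟨⟨‖x‖⁻¹ • x, ?_⟩, ?_, rfl⟩, smul_inv_smul₀ hpos.ne' x⟩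
    · rw [mem_sphere_zero_iff_norm, norm_smul, norm_inv, norm_norm, inv_mul_cancel₀ hpos.ne']
    · change _ ≤ inner ℝ (‖x‖⁻¹ • x) _
      rwa [real_inner_smul_left, inv_mul_eq_div, le_div_iff₀ hpos]

lemma measurableSet_sphericalCap {n : ℕ} (μ : unitSphere n) (θ : ℝ) :
    MeasurableSet (sphericalCap μ θ) :=
  measurableSet_le measurable_const (by fun_prop)

/-- The volume of a solid cone, cut off by the unit ball, as a multiple of an integral over the
half-plane. -/
lemma exists_volume_cone_eq {m : ℕ} (μ : unitSphere (m + 2)) : ∃ C : ℝ≥0∞, ∀ c : ℝ,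
    volume {x : EuclideanSpace ℝ (Fin (m + 2)) | x ≠ 0 ∧ ‖x‖ < 1 ∧
      c * ‖x‖ ≤ inner ℝ x (μ : EuclideanSpace ℝ (Fin (m + 2)))} =
    C * ∫⁻ p : ℝ × ℝ, ({p : ℝ × ℝ | 0 < p.2 ∧ p.1 ^ 2 + p.2 ^ 2 < 1 ∧
      c * √(p.1 ^ 2 + p.2 ^ 2) ≤ p.1}.indicator (fun p ↦ ENNReal.ofReal (p.2 ^ m)) p) := by
  set v : EuclideanSpace ℝ (Fin (m + 2)) := (μ : EuclideanSpace ℝ (Fin (m + 2)))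
  have hv1 : ‖v‖ = 1 := norm_eq_of_mem_sphere μ
  have hv0 : v ≠ 0 := fun h ↦ by simp [h] at hv1
  have hfin : Module.finrank ℝ (Submodule.span ℝ {v})ᗮ = m + 1 := by
    have : Fact (Module.finrank ℝ (EuclideanSpace ℝ (Fin (m + 2))) = m + 1 + 1) := ⟨by simp⟩
    exact Submodule.finrank_orthogonal_span_singleton hv0
  have : Nontrivial (Submodule.span ℝ {v})ᗮ :=
    Module.nontrivial_of_finrank_pos (R := ℝ) (by omega)
  obtain ⟨ψ, hψ⟩ := exists_continuousLinearEquiv_prod_orthogonal hv1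
  have : (Measure.map ψ volume).IsAddHaarMeasure := ψ.isAddHaarMeasure_map volume
  let ν : Measure (ℝ × (Submodule.span ℝ {v})ᗮ) := volume.prod volume
  -- Uniqueness of Haar measure suffices: the value of `κ` is irrelevant because it cancels in the
  -- final ratio.
  obtain ⟨κ, hmap⟩ : ∃ κ : ℝ≥0, Measure.map ψ volume = κ • ν :=
    ⟨_, Measure.isAddLeftInvariant_eq_smul (Measure.map ψ volume) ν⟩
  refine ⟨κ * (volume : Measure (Submodule.span ℝ {v})ᗮ).toSphere univ, fun c ↦ ?_⟩
  let A : Set (ℝ × ℝ) := {p | p.1 ^ 2 + p.2 ^ 2 < 1 ∧ c * √(p.1 ^ 2 + p.2 ^ 2) ≤ p.1}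
  have hA : MeasurableSet A :=
    MeasurableSet.inter
      (s₁ := {p : ℝ × ℝ | p.1 ^ 2 + p.2 ^ 2 < 1}) (s₂ := {p | c * √(p.1 ^ 2 + p.2 ^ 2) ≤ p.1})
      (measurableSet_lt (by fun_prop) (by fun_prop)) (measurableSet_le (by fun_prop) (by fun_prop))
  let T : Set (ℝ × (Submodule.span ℝ {v})ᗮ) := {q | (q.1, ‖q.2‖) ∈ A}
  have hT : MeasurableSet T := (show Measurable fun q : ℝ × (Submodule.span ℝ {v})ᗮ ↦
    (q.1, ‖q.2‖) by fun_prop) hA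
  have hcone : {x : EuclideanSpace ℝ (Fin (m + 2)) | x ≠ 0 ∧ ‖x‖ < 1 ∧ c * ‖x‖ ≤ inner ℝ x v} =
      (ψ ⁻¹' T) \ {0} := by
    ext x
    obtain ⟨h1, h2⟩ := hψ x
    simp only [T, A, mem_sdiff, mem_preimage, mem_ofPred_eq, mem_singleton_iff, h1, ← h2,
      Real.sqrt_sq (norm_nonneg x), sq_lt_one_iff₀ (norm_nonneg x)]
    tauto
  rw [hcone, measure_sdiff_null (measure_singleton _),
    ← Measure.map_apply ψ.continuous.measurable hT, hmap, Measure.smul_apply, Measure.prod_apply hT]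
  have hslice (t : ℝ) : volume (Prod.mk t ⁻¹' T) =
      (volume : Measure (Submodule.span ℝ {v})ᗮ).toSphere univ *
        ∫⁻ r in Ioi (0 : ℝ), ENNReal.ofReal (r ^ m) * (Prod.mk t ⁻¹' A).indicator 1 r := by
    have h := lintegral_fun_norm_addHaar (volume : Measure (Submodule.span ℝ {v})ᗮ)
      (f := (Prod.mk t ⁻¹' A).indicator 1)
      (measurable_one.indicator (measurable_prodMk_left hA))
    rw [hfin, Nat.add_sub_cancel] at h
    rw [← h, ← lintegral_indicator_one (measurable_prodMk_left hT)]
    rfl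
  have hmeas : Measurable (({p : ℝ × ℝ | 0 < p.2 ∧ p.1 ^ 2 + p.2 ^ 2 < 1 ∧
      c * √(p.1 ^ 2 + p.2 ^ 2) ≤ p.1}.indicator (fun p ↦ ENNReal.ofReal (p.2 ^ m)))) :=
    Measurable.indicator (by fun_prop)
      (MeasurableSet.inter (s₁ := {p : ℝ × ℝ | 0 < p.2})
        (measurableSet_lt (by fun_prop) (by fun_prop)) hA)
  have hinner (t : ℝ) :
      ∫⁻ r in Ioi (0 : ℝ), ENNReal.ofReal (r ^ m) * (Prod.mk t ⁻¹' A).indicator 1 r =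
      ∫⁻ r, {p : ℝ × ℝ | 0 < p.2 ∧ p.1 ^ 2 + p.2 ^ 2 < 1 ∧
        c * √(p.1 ^ 2 + p.2 ^ 2) ≤ p.1}.indicator (fun p ↦ ENNReal.ofReal (p.2 ^ m)) (t, r) := by
    rw [← lintegral_indicator measurableSet_Ioi]
    congr 1 with r
    by_cases hr : 0 < r
    · by_cases h : r ∈ Prod.mk t ⁻¹' A
      · rw [indicator_of_mem (mem_Ioi.2 hr), indicator_of_mem h,
          indicator_of_mem (a := (t, r)) (And.intro hr h), Pi.one_apply, mul_one]
      · rw [indicator_of_mem (mem_Ioi.2 hr), indicator_of_notMem h,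
          indicator_of_notMem fun h' ↦ h h'.2, mul_zero]
    · rw [indicator_of_notMem (notMem_Ioi.2 (not_lt.1 hr)), indicator_of_notMem fun h' ↦ hr h'.1]
  simp_rw [hslice, hinner]
  rw [lintegral_const_mul _ hmeas.lintegral_prod_right', Measure.volume_eq_prod,
    lintegral_prod _ hmeas.aemeasurable, mul_assoc]
  rfl

lemma exists_surfaceMeasure_real_sphericalCap {m : ℕ} (μ : unitSphere (m + 2)) :
    ∃ C : ℝ, ∀ θ ∈ Icc 0 Real.pi, (surfaceMeasure (m + 2)).real (sphericalCap μ θ) =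
      C * ∫ x in (0 : ℝ)..θ, Real.sin x ^ m := by
  obtain ⟨C, hC⟩ := exists_volume_cone_eq μ
  obtain ⟨D, hD⟩ := exists_lintegral_planar_cone m
  -- Finiteness of `C` and `D` need not be checked, since `toReal` is multiplicative even at `∞`.
  refine ⟨(((m + 2 : ℕ) : ℝ≥0∞) * C * D).toReal, fun θ hθ ↦ ?_⟩
  have hnonneg : 0 ≤ ∫ x in (0 : ℝ)..θ, Real.sin x ^ m :=
    intervalIntegral.integral_nonneg hθ.1 fun x hx ↦
      pow_nonneg (Real.sin_nonneg_of_nonneg_of_le_pi hx.1 (hx.2.trans hθ.2)) m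
  rw [measureReal_def, surfaceMeasure,
    Measure.toSphere_apply' _ (measurableSet_sphericalCap μ θ), Ioo_smul_image_sphericalCap, hC,
    hD θ hθ, finrank_euclideanSpace_fin, ← mul_assoc, ← mul_assoc, ENNReal.toReal_mul,
    ENNReal.toReal_ofReal hnonneg]

lemma sphericalCap_pi {n : ℕ} (μ : unitSphere n) : sphericalCap μ Real.pi = univ := by
  refine eq_univ_of_forall fun x ↦ ?_
  have h := neg_le_of_abs_le (abs_real_inner_le_norm (x : EuclideanSpace ℝ (Fin n)) μ)
  rw [norm_eq_of_mem_sphere, norm_eq_of_mem_sphere, one_mul] at h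
  simpa [sphericalCap] using h

lemma solidAngleFraction_eq_div {m : ℕ} (μ : unitSphere (m + 2)) {θ : ℝ}
    (hθ : θ ∈ Icc 0 Real.pi) :
    solidAngleFraction μ θ =
      (∫ x in (0 : ℝ)..θ, Real.sin x ^ m) / ∫ x in (0 : ℝ)..Real.pi, Real.sin x ^ m := by
  obtain ⟨C, hC⟩ := exists_surfaceMeasure_real_sphericalCap μ
  have huniv := hC Real.pi ⟨Real.pi_pos.le, le_rfl⟩
  rw [sphericalCap_pi] at huniv
  have hne : (surfaceMeasure (m + 2)).real univ ≠ 0 := by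
    have : IsFiniteMeasure (surfaceMeasure (m + 2)) := by
      unfold surfaceMeasure; infer_instance
    rw [Ne, measureReal_eq_zero_iff, Measure.measure_univ_eq_zero]
    exact Measure.toSphere_ne_zero _
  rw [solidAngleFraction, hC θ hθ, huniv, mul_div_mul_left]
  -- Cancelling `C` needs `C ≠ 0`; otherwise the whole sphere would have measure zero.
  rintro rfl
  exact hne (by rw [huniv, zero_mul])

/-! ### Assembly of the formulas and their inverses -/

theorem mainTheorem1 (n : ℕ) (hn : 2 ≤ n) (μ : unitSphere n) :
    (∀ θ ∈ Set.Icc (0 : ℝ) Real.pi,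
      solidAngleFraction μ θ =
        1 / ProbabilityTheory.beta (((n : ℝ) - 1) / 2) (1 / 2) *
          ∫ x in (0 : ℝ)..θ, Real.sin x ^ (n - 2)) ∧
    (∀ θ ∈ Set.Icc (0 : ℝ) (Real.pi / 2),
      solidAngleFraction μ θ =
        1 / 2 * regIncBeta (((n : ℝ) - 1) / 2) (1 / 2) (Real.sin θ ^ 2)) ∧
    (∀ θ ∈ Set.Icc (Real.pi / 2) Real.pi,
      solidAngleFraction μ θ =
        1 - 1 / 2 * regIncBeta (((n : ℝ) - 1) / 2) (1 / 2) (Real.sin θ ^ 2)) ∧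
    Set.BijOn (regIncBeta (((n : ℝ) - 1) / 2) (1 / 2)) (Set.Icc 0 1) (Set.Icc 0 1) ∧
    Set.BijOn (solidAngleFraction μ) (Set.Icc 0 Real.pi) (Set.Icc 0 1) ∧
    (∀ Ω ∈ Set.Icc (0 : ℝ) (1 / 2),
      invSolidAngleFraction μ Ω =
        Real.arcsin √(invRegIncBeta (((n : ℝ) - 1) / 2) (1 / 2) (2 * Ω))) ∧
    (∀ Ω ∈ Set.Icc (1 / 2 : ℝ) 1,
      invSolidAngleFraction μ Ω =
        Real.pi - Real.arcsin √(invRegIncBeta (((n : ℝ) - 1) / 2) (1 / 2) (2 * (1 - Ω)))) := by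
  obtain ⟨m, rfl⟩ : ∃ m, n = m + 2 := ⟨n - 2, by omega⟩
  have hcast : ((m + 2 : ℕ) : ℝ) - 1 = (m : ℝ) + 1 := by push_cast; ring
  rw [hcast, Nat.add_sub_cancel]
  have hpi := Real.pi_pos
  have hB : 0 < ProbabilityTheory.beta (((m : ℝ) + 1) / 2) (1 / 2) :=
    ProbabilityTheory.beta_pos (by positivity) (by positivity)
  have hΘ : ∀ θ ∈ Icc (0 : ℝ) Real.pi, solidAngleFraction μ θ =
      1 / ProbabilityTheory.beta (((m : ℝ) + 1) / 2) (1 / 2) *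
        ∫ x in (0 : ℝ)..θ, Real.sin x ^ m := fun θ hθ ↦ by
    rw [solidAngleFraction_eq_div μ hθ, beta_eq_integral_sin_pow, div_eq_mul_one_div, mul_comm]
  have hlow : ∀ θ ∈ Icc (0 : ℝ) (Real.pi / 2), solidAngleFraction μ θ =
      1 / 2 * regIncBeta (((m : ℝ) + 1) / 2) (1 / 2) (Real.sin θ ^ 2) := fun θ hθ ↦ by
    rw [hΘ θ ⟨hθ.1, by linarith [hθ.2]⟩, regIncBeta_sin_sq m hθ]
    ring
  have hsymm : ∀ θ ∈ Icc (0 : ℝ) Real.pi,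
      solidAngleFraction μ (Real.pi - θ) = 1 - solidAngleFraction μ θ := fun θ hθ ↦ by
    rw [hΘ θ hθ, hΘ _ ⟨by linarith [hθ.2], by linarith [hθ.1]⟩, integral_sin_pow_pi_sub,
      ← beta_eq_integral_sin_pow, mul_sub, one_div_mul_cancel hB.ne']
  have hbijI := bijOn_regIncBeta m
  have hbijΘ : BijOn (solidAngleFraction μ) (Icc 0 Real.pi) (Icc 0 1) :=
    (bijOn_integral_sin_pow_div_beta m).congr fun θ hθ ↦ (hΘ θ hθ).symm
  have hinv : ∀ y ∈ Icc (0 : ℝ) 1,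
      invRegIncBeta (((m : ℝ) + 1) / 2) (1 / 2) y ∈ Icc (0 : ℝ) 1 ∧
      regIncBeta (((m : ℝ) + 1) / 2) (1 / 2) (invRegIncBeta (((m : ℝ) + 1) / 2) (1 / 2) y) = y :=
    fun y hy ↦ ⟨Function.invFunOn_mem (hbijI.surjOn hy), Function.invFunOn_eq (hbijI.surjOn hy)⟩
  have hangle : ∀ y ∈ Icc (0 : ℝ) 1, solidAngleFraction μ
      (Real.arcsin √(invRegIncBeta (((m : ℝ) + 1) / 2) (1 / 2) y)) = y / 2 := fun y hy ↦ by
    rw [hlow _ (arcsin_sqrt_mem_Icc _), sin_arcsin_sqrt_sq (hinv y hy).1, (hinv y hy).2]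
    ring
  have hmem (x : ℝ) : Real.arcsin √x ∈ Icc (0 : ℝ) Real.pi :=
    ⟨(arcsin_sqrt_mem_Icc x).1, by linarith [(arcsin_sqrt_mem_Icc x).2]⟩
  -- By injectivity, each inverse formula only needs its right side to lie in `[0, π]` and to be
  -- sent to `Ω`.
  have hleft : ∀ θ ∈ Icc (0 : ℝ) Real.pi, ∀ Ω, solidAngleFraction μ θ = Ω →
      invSolidAngleFraction μ Ω = θ := by
    rintro θ hθ _ rfl
    exact hbijΘ.injOn.leftInvOn_invFunOn hθ
  refine ⟨hΘ, hlow, fun θ hθ ↦ ?_, hbijI, hbijΘ, fun Ω hΩ ↦ ?_, fun Ω hΩ ↦ ?_⟩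
  · have h := hsymm θ ⟨by linarith [hθ.1], hθ.2⟩
    rw [hlow _ ⟨by linarith [hθ.2], by linarith [hθ.1]⟩, Real.sin_pi_sub] at h
    linarith
  · refine hleft _ (hmem _) _ ?_
    rw [hangle _ ⟨by linarith [hΩ.1], by linarith [hΩ.2]⟩]
    ring
  · refine hleft _ ⟨by linarith [(hmem (invRegIncBeta (((m : ℝ) + 1) / 2) (1 / 2)
      (2 * (1 - Ω)))).2], by linarith [(hmem (invRegIncBeta (((m : ℝ) + 1) / 2) (1 / 2)
      (2 * (1 - Ω)))).1]⟩ _ ?_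
    rw [hsymm _ (hmem _), hangle _ ⟨by linarith [hΩ.2], by linarith [hΩ.1]⟩]
    ring
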